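/- Let $\kappa$ be an infinite cardinal. All topological groups are Hausdorff and carry the two-sided uniformity (the supremum of the left and the right uniformity); a group is complete if it is complete in this uniformity. A topological group is non-archimedean (NA) if the open subgroups form a local base at the identity, balanced if its left and right uniformities coincide, and Boolean if every nonidentity element has order two. The generalized Baire space $\kappa^{\aleph_0}$ is the product of $\aleph_0$ copies of the discrete uniform space of cardinality $\kappa$, with the product uniformity $\mathcal U$. For a class $\Omega$ of topological groups, the $\Omega$-free topological group of a uniform space $X$ is a group $F_\Omega(X)\in\Omega$ with a uniformly continuous map $i:X\to F_\Omega(X)$ such that for every uniformly continuous map $\varphi:X\to G$ with $G\in\Omega$ there is a unique continuous homomorphism $\Phi:F_\Omega(X)\to G$ with $\Phi\circ i=\varphi$. Write $F^b_{NA}$, $A_{NA}$, $B_{NA}$ for it when $\Omega$ is the class of all balanced NA, abelian NA, Boolean NA groups, respectively, and $\widehat G$ for the completion of $G$ with respect to the two-sided uniformity. A topological group $G$ is surjectively universal in a class $\Omega$ if $G\in\Omega$ and every $H\in\Omega$ is isomorphic, as a topological group, to a quotient $G/N$ by a normal subgroup $N$, with the quotient topology. Then the following completed free groups exist, and: 1.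 $\widehat{F^b_{NA}}(\kappa^{\aleph_0},\mathcal U)$ is surjectively universal in the class of all balanced NA metrizable complete groups of topological weight $\le\kappa$. 2. $\widehat{A}_{NA}(\kappa^{\aleph_0},\mathcal U)$ is surjectively universal in the class of all abelian NA metrizable complete groups of topological weight $\le\kappa$. 3. $\widehat{B}_{NA}(\kappa^{\aleph_0},\mathcal U)$ is surjectively universal in the class of all Boolean NA metrizable complete groups of topological weight $\le\kappa$. -/

import Mathlib

open Topology Cardinal

universe u

namespace NAGroups

/-- The two-sided uniformity of a topological group: the coarsest uniformity that is finer than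
both the left and the right uniformity (a finer uniformity is smaller in Mathlib's order, so that
this is an infimum there). -/
abbrev twoSidedUniformSpace (G : Type u) [Group G] [TopologicalSpace G] [IsTopologicalGroup G] :
    UniformSpace G :=
  IsTopologicalGroup.leftUniformSpace G ⊓ IsTopologicalGroup.rightUniformSpace G

/-- A topological group is complete if it is complete in its two-sided uniformity. -/
def IsCompleteGroup (G : Type u) [Group G] [TopologicalSpace G] [IsTopologicalGroup G] : Prop :=
  @CompleteSpace G (twoSidedUniformSpace G)

/-- A topological group is balanced (SIN) if its left and right uniformities coincide. -/
def IsBalanced (G : Type u) [Group G] [TopologicalSpace G] [IsTopologicalGroup G] : Prop :=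
  IsTopologicalGroup.leftUniformSpace G = IsTopologicalGroup.rightUniformSpace G

/-- A Boolean group: every nonidentity element has order two. -/
def IsBoolean (G : Type u) [Group G] : Prop :=
  ∀ x : G, x ≠ 1 → orderOf x = 2

/-- The topological weight of `X` is at most `κ`: there is a base of the topology with at most `κ`
members. -/
def WeightLE (κ : Cardinal.{u}) (X : Type u) [TopologicalSpace X] : Prop :=
  ∃ B : Set (Set X), TopologicalSpace.IsTopologicalBasis B ∧ #B ≤ κ

/-- A class of topological groups. -/
abbrev GroupClass :=
  ∀ (G : Type u) [Group G] [TopologicalSpace G] [IsTopologicalGroup G], Prop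

/-- Hausdorff balanced non-archimedean groups. -/
def BalancedNA : GroupClass.{u} := fun G _ _ _ =>
  T2Space G ∧ NonarchimedeanGroup G ∧ IsBalanced G

/-- Hausdorff abelian non-archimedean groups. -/
def AbelianNA : GroupClass.{u} := fun G _ _ _ =>
  T2Space G ∧ NonarchimedeanGroup G ∧ ∀ x y : G, x * y = y * x

/-- Hausdorff Boolean non-archimedean groups. -/
def BooleanNA : GroupClass.{u} := fun G _ _ _ =>
  T2Space G ∧ NonarchimedeanGroup G ∧ IsBoolean G

/-- The members of the class `Ω` that are metrizable, complete, and of weight at most `κ`. -/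
def MetrizableComplete (Ω : GroupClass.{u}) (κ : Cardinal.{u}) : GroupClass.{u} := fun G _ _ _ =>
  Ω G ∧ TopologicalSpace.MetrizableSpace G ∧ IsCompleteGroup G ∧ WeightLE κ G

/-- `(F, i)` is an `Ω`-free topological group of the uniform space `X`; topological groups are
considered with their two-sided uniformities. -/
structure IsFreeGroupOf (Ω : GroupClass.{u}) (X : Type u) [UniformSpace X]
    (F : Type u) [Group F] [TopologicalSpace F] [IsTopologicalGroup F] (i : X → F) : Prop where
  mem : Ω F
  uniformContinuous : @UniformContinuous X F _ (twoSidedUniformSpace F) i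
  universal : ∀ (G : Type u) [Group G] [TopologicalSpace G] [IsTopologicalGroup G], Ω G →
    ∀ φ : X → G, @UniformContinuous X G _ (twoSidedUniformSpace G) φ →
      ∃! Φ : F →ₜ* G, ∀ x, Φ (i x) = φ x

/-- `(C, j)` is the completion of the topological group `G` with respect to the two-sided
uniformity: `C` is a complete Hausdorff topological group and `j` is an isomorphism of topological
groups from `G` onto a dense subgroup of `C`. -/
structure IsGroupCompletion (G : Type u) [Group G] [TopologicalSpace G] [IsTopologicalGroup G]
    (C : Type u) [Group C] [TopologicalSpace C] [IsTopologicalGroup C] (j : G →* C) : Prop where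
  t2Space : T2Space C
  complete : IsCompleteGroup C
  isEmbedding : IsEmbedding j
  denseRange : DenseRange j

/-- `C` is the completion of the `Ω`-free topological group of the uniform space `X`. -/
def IsCompletedFreeGroupOf (Ω : GroupClass.{u}) (X : Type u) [UniformSpace X]
    (C : Type u) [Group C] [TopologicalSpace C] [IsTopologicalGroup C] : Prop :=
  ∃ (F : Type u) (_ : Group F) (_ : TopologicalSpace F) (_ : IsTopologicalGroup F)
    (i : X → F) (j : F →* C), IsFreeGroupOf Ω X F i ∧ IsGroupCompletion F C j

/-- `G` is surjectively universal (co-universal) in the class `Ω`: it belongs to `Ω`, and every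
member of `Ω` is isomorphic to a topological factor group of `G`. -/
def IsSurjectivelyUniversal (Ω : GroupClass.{u})
    (G : Type u) [Group G] [TopologicalSpace G] [IsTopologicalGroup G] : Prop :=
  Ω G ∧ ∀ (H : Type u) [Group H] [TopologicalSpace H] [IsTopologicalGroup H], Ω H →
    ∃ (N : Subgroup G) (_ : N.Normal), Nonempty ((G ⧸ N) ≃ₜ* H)

/-- The underlying set of the generalized Baire space: sequences in a set of cardinality `κ`. -/
def BaireSpc (κ : Cardinal.{u}) : Type u := ℕ → κ.out

/-- The uniformity of the generalized Baire space: the product of discrete uniformities. -/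
instance (κ : Cardinal.{u}) : UniformSpace (BaireSpc κ) :=
  @Pi.uniformSpace ℕ (fun _ => κ.out) (fun _ => ⊥)

end NAGroups

/-! Each of the three classes is a variety: Hausdorff groups with a base of open normal subgroups
(that is, balanced and NA, by `hasNormalBasis_iff`) satisfying a set `L` of laws, so one proof for
arbitrary `L` suffices.

The free group is explicit. Modulo an open normal subgroup, a uniformly continuous map on the Baire
space depends only on a finite prefix, so it factors through the relatively free group on prefixes
of one length (`lift_mem_of_level`). Hence the subgroup generated by the points of the Baire space
in the product of these discrete groups is free, and its closure is its completion. As a subgroup of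
a countable product of discrete groups of size at most `κ`, the completion is metrizable of weight
at most `κ`.

For universality, take a decreasing base of open normal subgroups `M n` of `H` and let `κ` enumerate
representatives of `M n` modulo `M (n + 1)`. Infinite products of representatives converge by
completeness and map each cylinder of length `n` onto a coset of `M n`
(`IsNormalFiltration.exists_map`). This map is uniformly continuous and onto; its extension to the
completed free group is onto, and open because cylinders go onto whole cosets. -/

open Filter Set

namespace NAGroups

/-! ### Two-sided completeness, normal bases and weight. -/

section Uniformities

variable {G : Type u} [Group G] [TopologicalSpace G] [IsTopologicalGroup G]

theorem uniformity_twoSided :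
    (twoSidedUniformSpace G).uniformity =
      comap (fun p : G × G => p.1⁻¹ * p.2) (𝓝 1) ⊓ comap (fun p : G × G => p.2 * p.1⁻¹) (𝓝 1) :=
  inf_uniformity

theorem IsCompleteGroup.exists_le_nhds (h : IsCompleteGroup G) {l : Filter G} [l.NeBot]
    (hl : Tendsto (fun p : G × G => p.1⁻¹ * p.2) (l ×ˢ l) (𝓝 1))
    (hr : Tendsto (fun p : G × G => p.2 * p.1⁻¹) (l ×ˢ l) (𝓝 1)) : ∃ x, l ≤ 𝓝 x := by
  have hc : @Cauchy G (twoSidedUniformSpace G) l := by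
    refine ⟨inferInstance, ?_⟩
    exact (le_inf hl.le_comap hr.le_comap).trans_eq uniformity_twoSided.symm
  obtain ⟨x, hx⟩ := h.complete hc
  have ht : (twoSidedUniformSpace G).toTopologicalSpace = ‹TopologicalSpace G› := by
    rw [UniformSpace.toTopologicalSpace_inf]
    exact inf_idem _
  rw [ht] at hx
  exact ⟨x, hx⟩

theorem twoSidedUniformSpace_eq {G : Type u} [u : UniformSpace G] [Group G] [IsUniformGroup G] :
    twoSidedUniformSpace G = u := by
  have hl : IsTopologicalGroup.leftUniformSpace G = u := by
    ext : 1
    rw [uniformity_eq_comap_nhds_one_left G, uniformity_eq_comap_inv_mul_nhds_one]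
  rw [twoSidedUniformSpace, hl, IsUniformGroup.rightUniformSpace_eq, inf_idem]

theorem isCompleteGroup_of_completeSpace {G : Type u} [UniformSpace G] [Group G]
    [IsUniformGroup G] [h : CompleteSpace G] : IsCompleteGroup G := by
  rw [IsCompleteGroup, twoSidedUniformSpace_eq]
  exact h

/-- Continuous homomorphisms into complete Hausdorff groups extend to the completion. -/
theorem IsGroupCompletion.exists_extension {F C H : Type u}
    [Group F] [TopologicalSpace F] [IsTopologicalGroup F]
    [Group C] [TopologicalSpace C] [IsTopologicalGroup C]
    [Group H] [TopologicalSpace H] [IsTopologicalGroup H] [T2Space H] {j : F →* C}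
    (hj : IsGroupCompletion F C j) (hH : IsCompleteGroup H) (f : F →ₜ* H) :
    ∃ g : C →ₜ* H, ∀ x, g (j x) = f x := by
  have di : IsDenseInducing j := ⟨hj.isEmbedding.isInducing, hj.denseRange⟩
  have h1 : Tendsto f (comap j (𝓝 1)) (𝓝 1) := by
    have := f.continuous_toFun.tendsto 1
    rw [di.isInducing.nhds_eq_comap] at this
    simpa using this
  have hlim : ∀ b, ∃ c, Tendsto f (comap j (𝓝 b)) (𝓝 c) := by
    intro b
    have := di.comap_nhds_neBot b
    have ha : Tendsto (fun p : F × F => j p.1) (comap j (𝓝 b) ×ˢ comap j (𝓝 b)) (𝓝 b) :=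
      tendsto_comap.comp tendsto_fst
    have hb : Tendsto (fun p : F × F => j p.2) (comap j (𝓝 b) ×ˢ comap j (𝓝 b)) (𝓝 b) :=
      tendsto_comap.comp tendsto_snd
    have hl := ha.inv.mul hb
    have hr := hb.mul ha.inv
    rw [inv_mul_cancel] at hl
    rw [mul_inv_cancel] at hr
    -- Since `j` is inducing, a quotient of two elements of `F` tending to 1 in `C` already does so
    -- in `F`, and then so does its image under `f`.
    have key : ∀ q : F × F → F,
        Tendsto (fun p => j (q p)) (comap j (𝓝 b) ×ˢ comap j (𝓝 b)) (𝓝 1) →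
        Tendsto (fun p => f (q p)) (comap j (𝓝 b) ×ˢ comap j (𝓝 b)) (𝓝 1) :=
      fun q hq => h1.comp (tendsto_comap_iff.2 hq)
    refine hH.exists_le_nhds (l := map f (comap j (𝓝 b))) ?_ ?_
    · rw [prod_map_map_eq, tendsto_map'_iff]
      simpa [Function.comp_def] using key (fun p => p.1⁻¹ * p.2) (by simpa using hl)
    · rw [prod_map_map_eq, tendsto_map'_iff]
      simpa [Function.comp_def] using key (fun p => p.2 * p.1⁻¹) (by simpa using hr)
  have hcont : Continuous (di.extend f) := di.continuous_extend hlim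
  have hext : ∀ x, di.extend f (j x) = f x := di.extend_eq f.continuous_toFun
  refine ⟨⟨MonoidHom.mk' (di.extend f) ?_, hcont⟩, hext⟩
  intro a b
  refine hj.denseRange.induction_on₂ (isClosed_eq (by fun_prop) (by fun_prop)) ?_ a b
  intro x y
  rw [← map_mul, hext, hext, hext, map_mul]

theorem IsGroupCompletion.hom_ext {F C H : Type u}
    [Group F] [TopologicalSpace F] [IsTopologicalGroup F]
    [Group C] [TopologicalSpace C] [IsTopologicalGroup C]
    [Group H] [TopologicalSpace H] [IsTopologicalGroup H] [T2Space H] {j : F →* C}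
    (hj : IsGroupCompletion F C j) {g g' : C →ₜ* H} (h : ∀ x, g (j x) = g' (j x)) (c : C) :
    g c = g' c :=
  congrFun (hj.denseRange.equalizer g.continuous_toFun g'.continuous_toFun (funext h)) c

/-- Two completions of the same group are isomorphic. -/
theorem IsGroupCompletion.exists_isInducing {F C D : Type u}
    [Group F] [TopologicalSpace F] [IsTopologicalGroup F]
    [Group C] [TopologicalSpace C] [IsTopologicalGroup C]
    [Group D] [TopologicalSpace D] [IsTopologicalGroup D] {j : F →* C} {k : F →* D}
    (hj : IsGroupCompletion F C j) (hk : IsGroupCompletion F D k) :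
    ∃ g : C →* D, IsEmbedding g := by
  have := hj.t2Space
  have := hk.t2Space
  obtain ⟨g, hg⟩ := hj.exists_extension hk.complete ⟨k, hk.isEmbedding.continuous⟩
  obtain ⟨g', hg'⟩ := hk.exists_extension hj.complete ⟨j, hj.isEmbedding.continuous⟩
  have hgg : ∀ c, g' (g c) = c :=
    hj.hom_ext (g := g'.comp g) (g' := ContinuousMonoidHom.id C) fun x => by
      change g' (g (j x)) = j x
      rw [hg]
      exact hg' x
  exact ⟨g.toMonoidHom, .of_leftInverse (f := g') hgg g'.continuous_toFun g.continuous_toFun⟩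

/-- The open normal subgroups form a local base at the identity. -/
def HasNormalBasis (G : Type u) [Group G] [TopologicalSpace G] : Prop :=
  ∀ U ∈ 𝓝 (1 : G), ∃ N : Subgroup G, N.Normal ∧ IsOpen (N : Set G) ∧ (N : Set G) ⊆ U

/-- A normal subgroup contains `a⁻¹ * b` exactly when it contains `b * a⁻¹`. Conversely, balance
puts all conjugates of some neighbourhood of 1 inside a given open subgroup, so its normal core is
open. -/
theorem hasNormalBasis_iff : HasNormalBasis G ↔ NonarchimedeanGroup G ∧ IsBalanced G := by
  constructor
  · intro h
    refine ⟨⟨fun U hU => ?_⟩, ?_⟩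
    · obtain ⟨N, -, ho, hN⟩ := h U hU
      exact ⟨⟨N, ho⟩, hN⟩
    · ext : 1
      change comap (fun p : G × G => p.1⁻¹ * p.2) (𝓝 1) = comap (fun p : G × G => p.2 * p.1⁻¹) (𝓝 1)
      refine le_antisymm ?_ ?_ <;> rintro s ⟨U, hU, hs⟩ <;> obtain ⟨N, hn, ho, hN⟩ := h U hU
      · exact ⟨N, ho.mem_nhds N.one_mem, fun p hp => hs (hN (hn.mem_comm hp))⟩
      · exact ⟨N, ho.mem_nhds N.one_mem, fun p hp => hs (hN (hn.mem_comm hp))⟩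
  · rintro ⟨h, hb⟩ U hU
    obtain ⟨V, hV⟩ := h.is_nonarchimedean U hU
    refine ⟨(V : Subgroup G).normalCore, inferInstance, ?_,
      fun v hv => hV (Subgroup.normalCore_le _ hv)⟩
    have hb' := congrArg (fun u : UniformSpace G => u.uniformity) hb
    change comap (fun p : G × G => p.1⁻¹ * p.2) (𝓝 1) =
      comap (fun p : G × G => p.2 * p.1⁻¹) (𝓝 1) at hb'
    have hmem : (fun p : G × G => p.2 * p.1⁻¹) ⁻¹' (V : Set G) ∈
        comap (fun p : G × G => p.1⁻¹ * p.2) (𝓝 1) := by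
      rw [hb']
      exact preimage_mem_comap (V.isOpen.mem_nhds V.one_mem)
    obtain ⟨W, hW, hWV⟩ := hmem
    refine Subgroup.isOpen_of_mem_nhds _ (g := 1) (mem_of_superset hW fun v hv b => ?_)
    -- The left quotient of this pair is `v`, the right one is the conjugate `b * v * b⁻¹`.
    have : (b, b * v) ∈ (fun p : G × G => p.1⁻¹ * p.2) ⁻¹' W := by simpa using hv
    exact hWV this

theorem HasNormalBasis.of_isInducing {G P : Type u} [Group G] [TopologicalSpace G]
    [Group P] [TopologicalSpace P] (h : HasNormalBasis P) {f : G →* P} (hf : IsInducing f) :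
    HasNormalBasis G := by
  intro U hU
  rw [hf.nhds_eq_comap, map_one] at hU
  obtain ⟨V, hV, hVU⟩ := hU
  obtain ⟨N, hn, ho, hN⟩ := h V hV
  exact ⟨N.comap f, hn.comap f, ho.preimage hf.continuous, (preimage_mono hN).trans hVU⟩

theorem hasNormalBasis_pi_nat {D : ℕ → Type u} [∀ i, Group (D i)]
    [∀ i, TopologicalSpace (D i)] [∀ i, DiscreteTopology (D i)] :
    HasNormalBasis (∀ i, D i) := by
  intro U hU
  rw [nhds_pi, Filter.mem_pi] at hU
  obtain ⟨I, hI, t, ht, htU⟩ := hU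
  have := hI.to_subtype
  let r : (∀ i, D i) →* (∀ i : I, D i) :=
    { toFun := fun f i => f i, map_one' := rfl, map_mul' := fun _ _ => rfl }
  have hr : Continuous r := continuous_pi fun i => continuous_apply _
  refine ⟨r.ker, inferInstance, (isOpen_discrete {1}).preimage hr, ?_⟩
  intro f hf
  refine htU fun i hi => ?_
  have : f i = 1 := congrFun hf ⟨i, hi⟩
  rw [this]
  exact mem_of_mem_nhds (ht i)

theorem WeightLE.of_isInducing {κ : Cardinal.{u}} {X Y : Type u} [TopologicalSpace X]
    [TopologicalSpace Y] (h : WeightLE κ Y) {f : X → Y} (hf : IsInducing f) : WeightLE κ X := by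
  obtain ⟨B, hB, hc⟩ := h
  exact ⟨_, hB.isInducing hf, mk_image_le.trans hc⟩

theorem weightLE_pi_nat {κ : Cardinal.{u}} (hκ : ℵ₀ ≤ κ) {D : ℕ → Type u} [∀ i, Nonempty (D i)]
    [∀ i, TopologicalSpace (D i)] [∀ i, DiscreteTopology (D i)] (hD : ∀ i, #(D i) ≤ κ) :
    WeightLE κ (∀ i, D i) := by
  -- A finite set of prescriptions may be contradictory; it then only contributes the empty set.
  let b : Finset (Σ i, D i) → Set (∀ i, D i) := fun s => {f | ∀ p ∈ s, f p.1 = p.2}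
  refine ⟨range b, ?_, ?_⟩
  · refine TopologicalSpace.isTopologicalBasis_of_isOpen_of_nhds ?_ ?_
    · rintro _ ⟨s, rfl⟩
      have : b s = ⋂ p ∈ s, (fun f : ∀ i, D i => f p.1) ⁻¹' {p.2} := by
        ext f
        simp [b]
      rw [this]
      exact isOpen_biInter_finset fun p _ => (isOpen_discrete _).preimage (continuous_apply _)
    · intro f U hf hU
      have := hU.mem_nhds hf
      rw [nhds_pi, Filter.mem_pi] at this
      obtain ⟨I, hI, t, ht, htU⟩ := this
      classical
      refine ⟨_, ⟨hI.toFinset.image fun i => ⟨i, f i⟩, rfl⟩, by simp [b], fun g hg => htU ?_⟩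
      intro i hi
      have : g i = f i := hg ⟨i, f i⟩ (by simpa using hi)
      rw [this]
      exact mem_of_mem_nhds (ht i)
  · refine mk_range_le.trans ?_
    have : Infinite (Σ i, D i) :=
      Infinite.of_surjective (fun p : Σ i, D i => p.1) fun i => ⟨⟨i, Classical.arbitrary _⟩, rfl⟩
    rw [mk_finset_of_infinite, mk_sigma]
    calc sum (fun i => #(D i)) ≤ sum (fun _ : ℕ => κ) := sum_le_sum _ _ hD
      _ = ℵ₀ * κ := by simp
      _ ≤ κ := by rw [mul_eq_max le_rfl hκ]; exact max_le hκ le_rfl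

end Uniformities

/-! ### Group laws and relatively free groups. -/

section Laws

/-- The group `G` satisfies all the laws `w = 1` with `w ∈ L`. -/
def SatisfiesLaws (L : Set (FreeGroup ℕ)) (G : Type u) [Group G] : Prop :=
  ∀ w ∈ L, ∀ f : ℕ → G, FreeGroup.lift f w = 1

variable {L : Set (FreeGroup ℕ)}

theorem map_lift {G H : Type u} [Group G] [Group H] (φ : G →* H) (f : ℕ → G) (w : FreeGroup ℕ) :
    φ (FreeGroup.lift f w) = FreeGroup.lift (fun n => φ (f n)) w :=
  DFunLike.congr_fun (FreeGroup.ext_hom (φ.comp (FreeGroup.lift f))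
    (FreeGroup.lift fun n => φ (f n)) fun n => by simp) w

theorem SatisfiesLaws.of_injective {G H : Type u} [Group G] [Group H] (h : SatisfiesLaws L H)
    (φ : G →* H) (hφ : Function.Injective φ) : SatisfiesLaws L G := fun w hw f =>
  hφ (by rw [map_lift, h w hw, map_one])

theorem SatisfiesLaws.of_surjective {G H : Type u} [Group G] [Group H] (h : SatisfiesLaws L G)
    (φ : G →* H) (hφ : Function.Surjective φ) : SatisfiesLaws L H := fun w hw f => by
  obtain ⟨g, rfl⟩ := hφ.comp_left f
  have := map_lift φ g w
  rw [h w hw, map_one] at this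
  exact this.symm

theorem SatisfiesLaws.pi_nat {D : ℕ → Type u} [∀ i, Group (D i)]
    (h : ∀ i, SatisfiesLaws L (D i)) : SatisfiesLaws L (∀ i, D i) := fun w hw f => by
  funext i
  have := map_lift (Pi.evalMonoidHom D i) f w
  rw [h i w hw] at this
  exact this

/-- The verbal subgroup of the free group on `S` given by the laws `L`. -/
def verbalSubgroup (L : Set (FreeGroup ℕ)) (S : Type u) : Subgroup (FreeGroup S) :=
  Subgroup.normalClosure {g | ∃ w ∈ L, ∃ f : ℕ → FreeGroup S, g = FreeGroup.lift f w}

instance (S : Type u) : (verbalSubgroup L S).Normal := Subgroup.normalClosure_normal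

/-- The relatively free group on `S` in the variety of groups given by the laws `L`, considered
as a discrete group. -/
def RelFree (L : Set (FreeGroup ℕ)) (S : Type u) : Type u := FreeGroup S ⧸ verbalSubgroup L S

instance (S : Type u) : Group (RelFree L S) :=
  inferInstanceAs (Group (FreeGroup S ⧸ verbalSubgroup L S))

instance (S : Type u) : UniformSpace (RelFree L S) := ⊥

instance (S : Type u) : DiscreteUniformity (RelFree L S) := ⟨rfl⟩

/-- The projection of the free group to the relatively free group. -/
def RelFree.mk (L : Set (FreeGroup ℕ)) (S : Type u) : FreeGroup S →* RelFree L S :=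
  QuotientGroup.mk' (verbalSubgroup L S)

theorem RelFree.mk_surjective (S : Type u) : Function.Surjective (RelFree.mk L S) :=
  QuotientGroup.mk'_surjective _

theorem RelFree.satisfiesLaws (S : Type u) : SatisfiesLaws L (RelFree L S) := fun w hw f => by
  obtain ⟨g, rfl⟩ := (RelFree.mk_surjective S).comp_left f
  change FreeGroup.lift (fun n => RelFree.mk L S (g n)) w = 1
  rw [← map_lift]
  exact (QuotientGroup.eq_one_iff _).2 (Subgroup.subset_normalClosure ⟨w, hw, g, rfl⟩)

/-- The canonical map of `S` into the relatively free group on `S`. -/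
def RelFree.of {S : Type u} (s : S) : RelFree L S := RelFree.mk L S (FreeGroup.of s)

theorem RelFree.exists_lift {S G : Type u} [Group G] (h : SatisfiesLaws L G) (f : S → G) :
    ∃ φ : RelFree L S →* G, ∀ s, φ (RelFree.of s) = f s := by
  refine ⟨QuotientGroup.lift _ (FreeGroup.lift f) ?_, fun s => ?_⟩
  · refine Subgroup.normalClosure_le_normal (N := (FreeGroup.lift f).ker) ?_
    rintro _ ⟨w, hw, g, rfl⟩
    change FreeGroup.lift f _ = 1
    rw [map_lift, h w hw]
  · exact (QuotientGroup.lift_mk' _ _ _).trans (by simp)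

theorem RelFree.mk_le {κ : Cardinal.{u}} (hκ : ℵ₀ ≤ κ) {S : Type u} (hS : #S ≤ κ) :
    #(RelFree L S) ≤ κ := by
  refine (mk_le_of_surjective (RelFree.mk_surjective S)).trans ?_
  cases isEmpty_or_nonempty S
  · exact ((lt_aleph0_of_finite _).le).trans hκ
  · rw [mk_freeGroup]
    exact max_le hS hκ

end Laws

/-! ### The three classes as varieties. -/

section Varieties

/-- Hausdorff balanced non-archimedean groups satisfying the laws `L`. -/
def VarietyNA (L : Set (FreeGroup ℕ)) : GroupClass.{u} := fun G _ _ _ =>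
  T2Space G ∧ HasNormalBasis G ∧ SatisfiesLaws L G

theorem VarietyNA.of_isEmbedding {L : Set (FreeGroup ℕ)} {G P : Type u}
    [Group G] [TopologicalSpace G] [IsTopologicalGroup G]
    [Group P] [TopologicalSpace P] [IsTopologicalGroup P]
    (h : VarietyNA L P) {f : G →* P} (hf : IsEmbedding f) : VarietyNA L G :=
  have := h.1
  ⟨hf.t2Space, h.2.1.of_isInducing hf.isInducing, h.2.2.of_injective f hf.injective⟩

theorem isBalanced_of_comm {G : Type u} [Group G] [TopologicalSpace G] [IsTopologicalGroup G]
    (h : ∀ x y : G, x * y = y * x) : IsBalanced G := by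
  ext : 1
  change comap (fun p : G × G => p.1⁻¹ * p.2) (𝓝 1) = comap (fun p : G × G => p.2 * p.1⁻¹) (𝓝 1)
  simp only [h _ (_⁻¹)]

theorem balancedNA_eq : BalancedNA.{u} = VarietyNA ∅ := by
  funext G _ _ _
  simp [BalancedNA, VarietyNA, hasNormalBasis_iff, SatisfiesLaws]

theorem abelianNA_eq : AbelianNA.{u} =
    VarietyNA {FreeGroup.of 0 * FreeGroup.of 1 * (FreeGroup.of 1 * FreeGroup.of 0)⁻¹} := by
  funext G _ _ _
  have h : SatisfiesLaws {FreeGroup.of 0 * FreeGroup.of 1 * (FreeGroup.of 1 * FreeGroup.of 0)⁻¹} G ↔ ∀ x y : G, x * y = y * x := by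
    constructor
    · intro h x y
      have := h _ rfl fun n => if n = 0 then x else y
      simpa [← mul_assoc, mul_inv_eq_iff_eq_mul] using this
    · rintro h _ rfl f
      simp [h (f 0) (f 1)]
  simp only [AbelianNA, VarietyNA, hasNormalBasis_iff, h, eq_iff_iff]
  exact ⟨fun ⟨h₁, h₂, h₃⟩ => ⟨h₁, ⟨h₂, isBalanced_of_comm h₃⟩, h₃⟩,
    fun ⟨h₁, h₂, h₃⟩ => ⟨h₁, h₂.1, h₃⟩⟩

theorem isBoolean_iff {G : Type u} [Group G] : IsBoolean G ↔ ∀ x : G, x ^ 2 = 1 := by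
  constructor
  · intro h x
    by_cases hx : x = 1
    · simp [hx]
    · rw [← h x hx, pow_orderOf_eq_one]
  · exact fun h x hx => orderOf_eq_prime (h x) hx

/-- Exponent two forces commutativity, which makes balance automatic. -/
theorem booleanNA_eq : BooleanNA.{u} = VarietyNA {FreeGroup.of 0 ^ 2} := by
  funext G _ _ _
  have h : SatisfiesLaws {FreeGroup.of 0 ^ 2} G ↔ ∀ x : G, x ^ 2 = 1 := by
    constructor
    · intro h x
      simpa using h _ rfl fun _ => x
    · rintro h _ rfl f
      simp [h]
  have hc : (∀ x : G, x ^ 2 = 1) → ∀ x y : G, x * y = y * x := fun h x y => by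
    have hi : ∀ z : G, z⁻¹ = z := fun z => inv_eq_of_mul_eq_one_left (by rw [← sq, h])
    rw [← hi (x * y), mul_inv_rev, hi, hi]
  simp only [BooleanNA, VarietyNA, hasNormalBasis_iff, h, isBoolean_iff, eq_iff_iff]
  exact ⟨fun ⟨h₁, h₂, h₃⟩ => ⟨h₁, ⟨h₂, isBalanced_of_comm (hc h₃)⟩, h₃⟩,
    fun ⟨h₁, h₂, h₃⟩ => ⟨h₁, h₂.1, h₃⟩⟩

end Varieties

/-! ### Uniform continuity on the Baire space. -/

section BaireSpace

variable {κ : Cardinal.{u}}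

theorem mem_uniformity_baireSpc {s : Set (BaireSpc κ × BaireSpc κ)} :
    s ∈ uniformity (BaireSpc κ) ↔
      ∃ n : ℕ, {p : BaireSpc κ × BaireSpc κ | ∀ i < n, p.1 i = p.2 i} ⊆ s := by
  have hu : uniformity (BaireSpc κ) =
      ⨅ i : ℕ, 𝓟 {p : BaireSpc κ × BaireSpc κ | p.1 i = p.2 i} := by
    let : UniformSpace κ.out := ⊥
    refine (Pi.uniformity (fun _ : ℕ => κ.out)).trans ?_
    refine iInf_congr fun i => ?_
    rw [DiscreteUniformity.eq_principal_setRelId, comap_principal]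
    rfl
  rw [hu, (hasBasis_iInf_principal_finite _).mem_iff]
  constructor
  · rintro ⟨t, ht, hts⟩
    obtain ⟨n, hn⟩ := ht.bddAbove
    refine ⟨n + 1, fun p hp => hts ?_⟩
    simp only [mem_iInter]
    exact fun i hi => hp i (Nat.lt_succ_of_le (hn hi))
  · rintro ⟨n, hn⟩
    refine ⟨Iio n, finite_Iio n, fun p hp => hn ?_⟩
    simp only [mem_iInter] at hp
    exact fun i hi => hp i hi

/-- Testing on normal subgroups makes the left and right conditions equivalent, so only one of them
remains. -/
theorem uniformContinuous_baireSpc_iff {G : Type u} [Group G] [TopologicalSpace G]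
    [IsTopologicalGroup G] (hG : HasNormalBasis G) {φ : BaireSpc κ → G} :
    @UniformContinuous _ _ _ (twoSidedUniformSpace G) φ ↔
      ∀ N : Subgroup G, N.Normal → IsOpen (N : Set G) →
        ∃ n : ℕ, ∀ x y : BaireSpc κ, (∀ i < n, x i = y i) → (φ x)⁻¹ * φ y ∈ N := by
  have hiff : @UniformContinuous _ _ _ (twoSidedUniformSpace G) φ ↔
      Tendsto (fun p : BaireSpc κ × BaireSpc κ => (φ p.1)⁻¹ * φ p.2) (uniformity _) (𝓝 1) ∧
      Tendsto (fun p : BaireSpc κ × BaireSpc κ => φ p.2 * (φ p.1)⁻¹) (uniformity _) (𝓝 1) := by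
    have := tendsto_inf (f := fun p : BaireSpc κ × BaireSpc κ => (φ p.1, φ p.2))
      (x := uniformity _) (y₁ := comap (fun p : G × G => p.1⁻¹ * p.2) (𝓝 1))
      (y₂ := comap (fun p : G × G => p.2 * p.1⁻¹) (𝓝 1))
    rw [tendsto_comap_iff, tendsto_comap_iff, ← uniformity_twoSided] at this
    exact this
  rw [hiff]
  constructor
  · rintro ⟨h, -⟩ N - ho
    obtain ⟨n, hn⟩ := mem_uniformity_baireSpc.1 (h (ho.mem_nhds N.one_mem))
    exact ⟨n, fun x y hxy => hn (a := (x, y)) hxy⟩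
  · intro h
    constructor <;> intro U hU <;> obtain ⟨N, hN, ho, hNU⟩ := hG U hU <;>
      obtain ⟨n, hn⟩ := h N hN ho <;> refine mem_uniformity_baireSpc.2 ⟨n, fun p hp => hNU ?_⟩
    · exact hn _ _ hp
    · exact hN.mem_comm (hn _ _ hp)

end BaireSpace

/-! ### The free group and its completion inside the tower. -/

section FreeGroups

variable (L : Set (FreeGroup ℕ)) (κ : Cardinal.{u})

/-- The product of the discrete relatively free groups on the finite levels of the Baire space. -/
abbrev Tower : Type u := ∀ n : ℕ, RelFree L (Fin n → κ.out)

/-- The canonical map of the Baire space into the tower. -/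
def toTower (x : BaireSpc κ) : Tower L κ := fun _ => RelFree.of fun i => x i

/-- The free group of the variety given by `L` over the Baire space. -/
def freeNA : Subgroup (Tower L κ) := (FreeGroup.lift (toTower L κ)).range

/-- The projection of the abstract free group to `freeNA`. -/
def toFreeNA : FreeGroup (BaireSpc κ) →* freeNA L κ := (FreeGroup.lift (toTower L κ)).rangeRestrict

/-- The canonical map of the Baire space into `freeNA`. -/
def ofFreeNA (x : BaireSpc κ) : freeNA L κ := toFreeNA L κ (FreeGroup.of x)

variable {L κ}

theorem toFreeNA_surjective : Function.Surjective (toFreeNA L κ) :=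
  MonoidHom.rangeRestrict_surjective _

theorem coe_ofFreeNA (x : BaireSpc κ) : (ofFreeNA L κ x : Tower L κ) = toTower L κ x :=
  FreeGroup.lift_apply_of

theorem varietyNA_tower : VarietyNA L (Tower L κ) :=
  ⟨inferInstance, hasNormalBasis_pi_nat, .pi_nat fun _ => RelFree.satisfiesLaws _⟩

theorem varietyNA_freeNA : VarietyNA L (freeNA L κ) :=
  varietyNA_tower.of_isEmbedding (f := (freeNA L κ).subtype) .subtypeVal

/-- A basic neighbourhood constrains finitely many levels, and these see only a bounded prefix of
each point. -/
theorem exists_level {N : Subgroup (freeNA L κ)} (hN : IsOpen (N : Set (freeNA L κ))) :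
    ∃ n : ℕ, ∀ x y : BaireSpc κ, (∀ i < n, x i = y i) →
      (ofFreeNA L κ x)⁻¹ * ofFreeNA L κ y ∈ N := by
  have := hN.mem_nhds N.one_mem
  rw [Topology.IsInducing.subtypeVal.nhds_eq_comap, nhds_pi] at this
  obtain ⟨V, hV, hVN⟩ := this
  obtain ⟨I, hI, t, ht, htV⟩ := Filter.mem_pi.1 hV
  obtain ⟨n, hn⟩ := hI.bddAbove
  refine ⟨n, fun x y hxy => hVN (htV fun i hi => ?_)⟩
  have : toTower L κ x i = toTower L κ y i := by
    unfold toTower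
    congr 1
    funext k
    exact hxy k (k.2.trans_le (hn hi))
  have h1 : (((ofFreeNA L κ x)⁻¹ * ofFreeNA L κ y : freeNA L κ) : Tower L κ) i = 1 := by
    rw [Subgroup.coe_mul, Subgroup.coe_inv, coe_ofFreeNA, coe_ofFreeNA, Pi.mul_apply,
      Pi.inv_apply, this, inv_mul_cancel]
  rw [h1]
  exact mem_of_mem_nhds (ht i)

/-- Modulo an open normal subgroup, maps of the Baire space factor through a finite level. -/
theorem lift_mem_of_level [Nonempty κ.out] {G : Type u} [Group G] (hG : SatisfiesLaws L G)
    {φ : BaireSpc κ → G} {N : Subgroup G} [N.Normal] {n : ℕ}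
    (hn : ∀ x y : BaireSpc κ, (∀ i < n, x i = y i) → (φ x)⁻¹ * φ y ∈ N)
    {w : FreeGroup (BaireSpc κ)} (hw : (toFreeNA L κ w : Tower L κ) n = 1) :
    FreeGroup.lift φ w ∈ N := by
  -- Any extension of a prefix will do, since `φ` modulo `N` ignores the coordinates from `n` on.
  let e : (Fin n → κ.out) → BaireSpc κ := fun s i =>
    if h : i < n then s ⟨i, h⟩ else Classical.arbitrary _
  obtain ⟨ψ, hψ⟩ := RelFree.exists_lift
    (hG.of_surjective (QuotientGroup.mk' N) (QuotientGroup.mk'_surjective N))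
    fun s => QuotientGroup.mk' N (φ (e s))
  have key : ((ψ.comp (Pi.evalMonoidHom (fun n => RelFree L (Fin n → κ.out)) n)).comp
      (freeNA L κ).subtype).comp (toFreeNA L κ) =
      (QuotientGroup.mk' N).comp (FreeGroup.lift φ) := by
    refine FreeGroup.ext_hom _ _ fun x => ?_
    change ψ ((ofFreeNA L κ x : Tower L κ) n) = QuotientGroup.mk' N (FreeGroup.lift φ _)
    rw [coe_ofFreeNA, toTower, hψ, FreeGroup.lift_apply_of]
    exact QuotientGroup.eq.2 (hn _ _ fun i hi => by simp [e, hi])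
  have := DFunLike.congr_fun key w
  rw [← QuotientGroup.ker_mk' N, MonoidHom.mem_ker, ← MonoidHom.comp_apply, ← this]
  change ψ ((toFreeNA L κ w : Tower L κ) n) = 1
  rw [hw, map_one]

variable (L) in
theorem isFreeGroupOf_freeNA [Nonempty κ.out] :
    IsFreeGroupOf (VarietyNA L) (BaireSpc κ) (freeNA L κ) (ofFreeNA L κ) where
  mem := varietyNA_freeNA
  uniformContinuous := (uniformContinuous_baireSpc_iff varietyNA_freeNA.2.1).2
    fun _ _ ho => exists_level ho
  universal G _ _ _ hG φ hφ := by
    have := hG.1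
    rw [uniformContinuous_baireSpc_iff hG.2.1] at hφ
    -- As `G` is Hausdorff, a nontrivial value would be missed by some open normal subgroup,
    -- contradicting triviality at the corresponding level.
    have hker : (toFreeNA L κ).ker ≤ (FreeGroup.lift φ).ker := by
      intro w hw
      by_contra hne
      obtain ⟨N, hN, ho, hNU⟩ := hG.2.1 {FreeGroup.lift φ w}ᶜ
        (isOpen_compl_singleton.mem_nhds fun h => hne (Eq.symm h))
      obtain ⟨n, hn⟩ := hφ N hN ho
      refine hNU (lift_mem_of_level hG.2.2 hn (w := w) ?_) rfl
      rw [MonoidHom.mem_ker.1 hw]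
      rfl
    let Φ : freeNA L κ →* G :=
      (toFreeNA L κ).liftOfSurjective toFreeNA_surjective ⟨FreeGroup.lift φ, hker⟩
    have hΦ : ∀ w, Φ (toFreeNA L κ w) = FreeGroup.lift φ w := fun w =>
      MonoidHom.liftOfRightInverse_comp_apply _ _ _ _ w
    have hcont : Continuous Φ := by
      refine continuous_of_continuousAt_one Φ fun U hU => ?_
      rw [map_one] at hU
      obtain ⟨N, hN, ho, hNU⟩ := hG.2.1 U hU
      obtain ⟨n, hn⟩ := hφ N hN ho
      have hV : IsOpen {f : freeNA L κ | (f : Tower L κ) n = 1} :=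
        (isOpen_discrete {(1 : RelFree L (Fin n → κ.out))}).preimage
          (f := fun f : freeNA L κ => (f : Tower L κ) n)
          ((continuous_apply n).comp continuous_subtype_val)
      have hV1 := hV.mem_nhds (x := (1 : freeNA L κ)) rfl
      refine Filter.mem_map.2 (mem_of_superset hV1 fun f hf => hNU ?_)
      obtain ⟨w, rfl⟩ := toFreeNA_surjective f
      rw [hΦ]
      exact lift_mem_of_level hG.2.2 hn hf
    refine ⟨⟨Φ, hcont⟩, fun x => (hΦ _).trans FreeGroup.lift_apply_of, fun Ψ hΨ => ?_⟩
    ext f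
    obtain ⟨w, rfl⟩ := toFreeNA_surjective f
    have : Ψ.toMonoidHom.comp (toFreeNA L κ) = Φ.comp (toFreeNA L κ) := by
      refine FreeGroup.ext_hom _ _ fun x => ?_
      exact (hΨ x).trans ((hΦ _).trans FreeGroup.lift_apply_of).symm
    exact DFunLike.congr_fun this w

variable (L κ) in
theorem isGroupCompletion_freeNA :
    IsGroupCompletion (freeNA L κ) (freeNA L κ).topologicalClosure
      (Subgroup.inclusion (freeNA L κ).le_topologicalClosure) where
  t2Space := inferInstance
  complete :=
    have : CompleteSpace (freeNA L κ).topologicalClosure :=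
      (freeNA L κ).isClosed_topologicalClosure.completeSpace_coe
    isCompleteGroup_of_completeSpace
  isEmbedding := .inclusion (freeNA L κ).le_topologicalClosure
  denseRange := by
    refine Subtype.dense_iff.2 fun x hx => ?_
    refine closure_mono ?_ hx
    exact fun y hy => ⟨_, ⟨⟨y, hy⟩, rfl⟩, rfl⟩

/-- Free topological groups are unique up to isomorphism. -/
theorem IsFreeGroupOf.exists_equiv {Ω : GroupClass.{u}} {X F F' : Type u} [UniformSpace X]
    [Group F] [TopologicalSpace F] [IsTopologicalGroup F]
    [Group F'] [TopologicalSpace F'] [IsTopologicalGroup F'] {i : X → F} {i' : X → F'}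
    (h : IsFreeGroupOf Ω X F i) (h' : IsFreeGroupOf Ω X F' i') :
    Nonempty (F ≃ₜ* F') := by
  obtain ⟨a, ha, -⟩ := h.universal F' h'.mem i' h'.uniformContinuous
  obtain ⟨b, hb, -⟩ := h'.universal F h.mem i h.uniformContinuous
  have hba : b.comp a = ContinuousMonoidHom.id F :=
    (h.universal F h.mem i h.uniformContinuous).unique
      (fun x => (congrArg b (ha x)).trans (hb x)) fun _ => rfl
  have hab : a.comp b = ContinuousMonoidHom.id F' :=
    (h'.universal F' h'.mem i' h'.uniformContinuous).unique
      (fun x => (congrArg a (hb x)).trans (ha x)) fun _ => rfl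
  exact ⟨{ toFun := a, invFun := b, map_mul' := map_mul a
           left_inv := DFunLike.congr_fun hba
           right_inv := DFunLike.congr_fun hab
           continuous_toFun := a.continuous_toFun
           continuous_invFun := b.continuous_toFun }⟩

theorem IsGroupCompletion.comp_equiv {F F' C : Type u}
    [Group F] [TopologicalSpace F] [IsTopologicalGroup F]
    [Group F'] [TopologicalSpace F'] [IsTopologicalGroup F']
    [Group C] [TopologicalSpace C] [IsTopologicalGroup C] {j : F →* C}
    (h : IsGroupCompletion F C j) (e : F' ≃ₜ* F) :
    IsGroupCompletion F' C (j.comp e.toMulEquiv.toMonoidHom) where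
  t2Space := h.t2Space
  complete := h.complete
  isEmbedding := h.isEmbedding.comp e.toHomeomorph.isEmbedding
  denseRange := h.denseRange.comp e.surjective.denseRange h.isEmbedding.continuous

/-- Uniqueness of free groups and of completions transfers the concrete model to an arbitrary `C`.
-/
theorem IsCompletedFreeGroupOf.exists_isEmbedding [Nonempty κ.out] {C : Type u} [Group C]
    [TopologicalSpace C] [IsTopologicalGroup C]
    (h : IsCompletedFreeGroupOf (VarietyNA L) (BaireSpc κ) C) :
    ∃ f : C →* Tower L κ, IsEmbedding f := by
  obtain ⟨F, _, _, _, i, j, hF, hj⟩ := h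
  obtain ⟨e⟩ := (isFreeGroupOf_freeNA L).exists_equiv hF
  obtain ⟨g, hg⟩ := (hj.comp_equiv e).exists_isInducing (isGroupCompletion_freeNA L κ)
  exact ⟨(Subgroup.subtype _).comp g, IsEmbedding.subtypeVal.comp hg⟩

theorem IsCompletedFreeGroupOf.metrizableComplete (hκ : ℵ₀ ≤ κ) {C : Type u} [Group C]
    [TopologicalSpace C] [IsTopologicalGroup C]
    (h : IsCompletedFreeGroupOf (VarietyNA L) (BaireSpc κ) C) :
    MetrizableComplete (VarietyNA L) κ C := by
  have : Nonempty κ.out := by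
    rw [← mk_ne_zero_iff, mk_out]
    exact (aleph0_pos.trans_le hκ).ne'
  obtain ⟨f, hf⟩ := h.exists_isEmbedding
  obtain ⟨F, _, _, _, i, j, hF, hj⟩ := h
  refine ⟨varietyNA_tower.of_isEmbedding hf, hf.metrizableSpace, hj.complete, ?_⟩
  refine WeightLE.of_isInducing (weightLE_pi_nat hκ fun n => RelFree.mk_le hκ ?_) hf.isInducing
  have hpow : #(Fin n → κ.out) = κ ^ n := by
    simp [mk_pi]
  rw [hpow]
  exact power_nat_le hκ

end FreeGroups

/-! ### Quotient maps onto a given complete group. -/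

section Universality

variable {κ : Cardinal.{u}} {H : Type u} [Group H] [TopologicalSpace H] [IsTopologicalGroup H]

/-- A decreasing sequence of open normal subgroups that is a local base at the identity. -/
structure IsNormalFiltration (M : ℕ → Subgroup H) : Prop where
  normal : ∀ n, (M n).Normal
  isOpen : ∀ n, IsOpen (M n : Set H)
  antitone : Antitone M
  zero : M 0 = ⊤
  basis : ∀ U ∈ 𝓝 (1 : H), ∃ n, (M n : Set H) ⊆ U

theorem HasNormalBasis.exists_filtration {H : Type u} [Group H] [TopologicalSpace H]
    [FirstCountableTopology H] (h : HasNormalBasis H) :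
    ∃ M : ℕ → Subgroup H, IsNormalFiltration M := by
  obtain ⟨V, hV⟩ := (𝓝 (1 : H)).exists_antitone_basis
  choose N hN ho hNV using fun n => h (V n) (hV.1.mem_of_mem trivial)
  -- Starting at `⊤` lets the cylinder of length 0, the whole Baire space, map onto all of `H`.
  let M : ℕ → Subgroup H := fun n => Nat.rec ⊤ (fun k K => K ⊓ N k) n
  have hM : ∀ n, M (n + 1) = M n ⊓ N n := fun _ => rfl
  refine ⟨M, fun n => ?_, fun n => ?_, antitone_nat_of_succ_le fun n => ?_, rfl, fun U hU => ?_⟩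
  · induction n with
    | zero => exact inferInstanceAs (⊤ : Subgroup H).Normal
    | succ n ih =>
      exact Subgroup.normal_inf_normal (hH := ih) (hK := hN n)
  · induction n with
    | zero => exact isOpen_univ
    | succ n ih => exact ih.inter (ho n)
  · rw [hM]
    exact inf_le_left
  · obtain ⟨n, -, hn⟩ := hV.1.mem_iff.1 hU
    exact ⟨n + 1, fun x hx => hn (hNV n hx.2)⟩

/-- Cosets of `M` are disjoint nonempty open sets, so choosing a nonempty base member inside each is
injective. -/
theorem WeightLE.mk_quotient_le (h : WeightLE κ H) {M : Subgroup H} (ho : IsOpen (M : Set H)) :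
    #(H ⧸ M) ≤ κ := by
  obtain ⟨B, hB, hc⟩ := h
  have hopen : ∀ q : H ⧸ M, IsOpen ((QuotientGroup.mk : H → H ⧸ M) ⁻¹' {q}) := fun q => by
    have := QuotientGroup.discreteTopology ho
    exact (isOpen_discrete {q}).preimage QuotientGroup.continuous_mk
  choose b hbB hqb hbq using fun q : H ⧸ M =>
    hB.exists_subset_of_mem_open (show q.out ∈ QuotientGroup.mk ⁻¹' {q} from q.out_eq) (hopen q)
  refine le_trans (mk_le_of_injective (f := fun q => (⟨b q, hbB q⟩ : B)) fun q r hqr => ?_) hc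
  have : q.out ∈ b r := (Subtype.mk.inj hqr) ▸ hqb q
  exact q.out_eq.symm.trans (hbq r this)

theorem WeightLE.exists_transversal (h : WeightLE κ H) {M M' : Subgroup H} (hM : M' ≤ M)
    (ho : IsOpen (M' : Set H)) :
    ∃ a : κ.out → H, (∀ k, a k ∈ M) ∧ ∀ g ∈ M, ∃ k, (a k)⁻¹ * g ∈ M' := by
  have hle : #(H ⧸ M') ≤ #κ.out := by
    rw [mk_out]
    exact h.mk_quotient_le ho
  obtain ⟨e⟩ := hle
  classical
  let s : κ.out → H := fun k => (Function.invFun e k).out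
  -- `s` represents all cosets of `M'` in `H`. Replacing those outside `M` by 1 loses nothing: a
  -- coset of `M'` that meets `M` lies in `M`.
  refine ⟨fun k => if s k ∈ M then s k else 1, fun k => ?_, fun g hg => ?_⟩
  · dsimp only
    split_ifs with hk
    exacts [hk, M.one_mem]
  · obtain ⟨k, hk⟩ := Function.invFun_surjective e.injective (g : H ⧸ M')
    have h1 : (s k)⁻¹ * g ∈ M' := QuotientGroup.eq.1 (by simp [s, hk])
    have h2 : s k ∈ M := by
      have := M.mul_mem hg (M.inv_mem (hM h1))
      simpa using this
    exact ⟨k, by simpa [h2] using h1⟩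

/-- The partial products `a 0 (x 0) * ⋯ * a (n - 1) (x (n - 1))`. -/
def partialProd {H K : Type u} [Group H] (a : ℕ → K → H) (x : ℕ → K) : ℕ → H
  | 0 => 1
  | n + 1 => partialProd a x n * a n (x n)

theorem partialProd_congr {H K : Type u} [Group H] {a : ℕ → K → H} {x y : ℕ → K} {n : ℕ}
    (h : ∀ i < n, x i = y i) : partialProd a x n = partialProd a y n := by
  induction n with
  | zero => rfl
  | succ n ih =>
    rw [partialProd, partialProd, ih fun i hi => h i (hi.trans n.lt_succ_self),
      h n n.lt_succ_self]

theorem partialProd_mem {H K : Type u} [Group H] {a : ℕ → K → H} {M : ℕ → Subgroup H} (hM : Antitone M)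
    (ha : ∀ n k, a n k ∈ M n) (x : ℕ → K) {n m : ℕ} (hnm : n ≤ m) :
    (partialProd a x n)⁻¹ * partialProd a x m ∈ M n := by
  induction m, hnm using Nat.le_induction with
  | base => simp
  | succ m hnm ih =>
    rw [partialProd, ← mul_assoc]
    exact (M n).mul_mem ih (hM hnm (ha m _))

/-- Normality makes the sequence Cauchy on both sides; the congruences survive in the limit because
open subgroups are closed. -/
theorem IsNormalFiltration.exists_limit {M : ℕ → Subgroup H} (hM : IsNormalFiltration M)
    (hH : IsCompleteGroup H) {p : ℕ → H} (hp : ∀ n m, n ≤ m → (p n)⁻¹ * p m ∈ M n) :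
    ∃ g, ∀ n, (p n)⁻¹ * g ∈ M n := by
  have hp' : ∀ n, ∀ᶠ q in (map p atTop) ×ˢ (map p atTop), q.1⁻¹ * q.2 ∈ M n := fun n => by
    rw [prod_map_map_eq, eventually_map]
    filter_upwards [(eventually_ge_atTop n).prod_mk (eventually_ge_atTop n)] with q hq
    have := (M n).mul_mem ((M n).inv_mem (hp n q.1 hq.1)) (hp n q.2 hq.2)
    simpa [mul_assoc] using this
  obtain ⟨g, hg⟩ := hH.exists_le_nhds (l := map p atTop)
    (fun U hU => by
      obtain ⟨n, hn⟩ := hM.basis U hU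
      exact (hp' n).mono fun q hq => hn hq)
    (fun U hU => by
      obtain ⟨n, hn⟩ := hM.basis U hU
      exact (hp' n).mono fun q hq => hn ((hM.normal n).mem_comm hq))
  refine ⟨g, fun n => ?_⟩
  have hcl : IsClosed (M n : Set H) := (M n).isClosed_of_isOpen (hM.isOpen n)
  have ht : Tendsto (fun m => (p n)⁻¹ * p m) atTop (𝓝 ((p n)⁻¹ * g)) :=
    Tendsto.const_mul _ hg
  exact hcl.mem_of_tendsto ht ((eventually_ge_atTop n).mono fun m hm => hp n m hm)

theorem IsNormalFiltration.eq_of_forall_mem {H : Type u} [Group H] [TopologicalSpace H]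
    [T2Space H] {M : ℕ → Subgroup H}
    (hM : IsNormalFiltration M) {g h : H} (hgh : ∀ n, g⁻¹ * h ∈ M n) : g = h := by
  by_contra hne
  obtain ⟨n, hn⟩ := hM.basis {g⁻¹ * h}ᶜ (isOpen_compl_singleton.mem_nhds fun h1 =>
    hne (inv_mul_eq_one.1 (Eq.symm h1)))
  exact hn (hgh n) rfl

/-- A map of the Baire space onto `H` that maps the cylinders onto cosets of the members of a
normal filtration. -/
theorem IsNormalFiltration.exists_map [T2Space H] {M : ℕ → Subgroup H}
    (hM : IsNormalFiltration M) (hH : IsCompleteGroup H) (hw : WeightLE κ H) :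
    ∃ φ : BaireSpc κ → H, Function.Surjective φ ∧
      (∀ n x y, (∀ i < n, x i = y i) → (φ x)⁻¹ * φ y ∈ M n) ∧
      ∀ n x h, (φ x)⁻¹ * h ∈ M n → ∃ y : BaireSpc κ, (∀ i < n, x i = y i) ∧ φ y = h := by
  choose a haM hac using fun n =>
    hw.exists_transversal (hM.antitone (Nat.le_succ n)) (hM.isOpen (n + 1))
  choose φ hφ using fun x : BaireSpc κ =>
    hM.exists_limit hH fun n m hnm => partialProd_mem hM.antitone haM x hnm
  -- Keep the first `n` digits of `x`, then choose each further digit greedily so that the error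
  -- against `h` drops to the next member of the filtration.
  have hex : ∀ n x h, (partialProd a x n)⁻¹ * h ∈ M n →
      ∃ y : BaireSpc κ, (∀ i < n, x i = y i) ∧ φ y = h := by
    intro n x h hh
    classical
    have : Nonempty κ.out := ⟨(hac 0 1 (M 0).one_mem).choose⟩
    let c : ℕ → H → κ.out := fun m g => Classical.epsilon fun k => (a m k)⁻¹ * g ∈ M (m + 1)
    have hc : ∀ m, ∀ g ∈ M m, (a m (c m g))⁻¹ * g ∈ M (m + 1) := fun m g hg =>
      Classical.epsilon_spec (hac m g hg)
    -- The digits of `y` depend on its own partial products, so these are built first by recursion.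
    let q : ℕ → H := fun m => Nat.rec 1
      (fun m g => g * a m (if m < n then x m else c m (g⁻¹ * h))) m
    let y : BaireSpc κ := fun m => if m < n then x m else c m ((q m)⁻¹ * h)
    have hxy : ∀ i < n, x i = y i := fun i hi => by simp [y, hi]
    have hq : ∀ m, partialProd a y m = q m := by
      intro m
      induction m with
      | zero => rfl
      | succ m ih =>
        rw [partialProd, ih]
    have hqh : ∀ m, n ≤ m → (partialProd a y m)⁻¹ * h ∈ M m := by
      intro m hm
      induction m, hm using Nat.le_induction with
      | base => rwa [← partialProd_congr hxy]
      | succ m hm ih =>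
        have hy : y m = c m ((partialProd a y m)⁻¹ * h) := by
          rw [hq]
          simp [y, hm.not_gt]
        have := hc m _ ih
        rw [← hy] at this
        rw [partialProd, mul_inv_rev, mul_assoc]
        exact this
    refine ⟨y, hxy, hM.eq_of_forall_mem fun m => ?_⟩
    have h1 := (M (max n m)).mul_mem ((M (max n m)).inv_mem (hφ y (max n m)))
      (hqh (max n m) (le_max_left _ _))
    have h2 := hM.antitone (le_max_right n m) h1
    simpa [mul_assoc] using h2
  refine ⟨φ, fun h => ?_, fun n x y hxy => ?_, fun n x h hh => hex n x h ?_⟩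
  · obtain ⟨k, -⟩ := hac 0 1 (M 0).one_mem
    obtain ⟨y, -, hy⟩ := hex 0 (fun _ => k) h (by rw [hM.zero]; trivial)
    exact ⟨y, hy⟩
  · have h1 := hφ x n
    rw [partialProd_congr hxy] at h1
    simpa [mul_assoc] using (M n).mul_mem ((M n).inv_mem h1) (hφ y n)
  · simpa [mul_assoc] using (M n).mul_mem (hφ x n) hh

theorem nonempty_quotient_equiv {H C : Type u} [Group H] [TopologicalSpace H] [Group C] [TopologicalSpace C]
    [IsTopologicalGroup C] (f : C →* H) (hc : Continuous f) (ho : IsOpenMap f)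
    (hs : Function.Surjective f) : Nonempty ((C ⧸ f.ker) ≃ₜ* H) := by
  refine ⟨(QuotientGroup.quotientKerEquivOfSurjective f hs).toContinuousMulEquiv fun s => ?_⟩
  rw [← (ho.isQuotientMap hc hs).isOpen_preimage,
    ← (QuotientGroup.isQuotientMap_mk f.ker).isOpen_preimage]
  rfl

theorem IsCompletedFreeGroupOf.exists_quotient {L : Set (FreeGroup ℕ)} {C : Type u} [Group C]
    [TopologicalSpace C] [IsTopologicalGroup C]
    (h : IsCompletedFreeGroupOf (VarietyNA L) (BaireSpc κ) C)
    (hH : MetrizableComplete (VarietyNA L) κ H) :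
    ∃ (N : Subgroup C) (_ : N.Normal), Nonempty ((C ⧸ N) ≃ₜ* H) := by
  obtain ⟨F, _, _, _, i, j, hF, hj⟩ := h
  obtain ⟨hV, _, hcomp, hw⟩ := hH
  have := hV.1
  obtain ⟨M, hM⟩ := hV.2.1.exists_filtration
  obtain ⟨φ, hsurj, hcont, hopen⟩ := hM.exists_map hcomp hw
  have hφ : @UniformContinuous _ _ _ (twoSidedUniformSpace H) φ :=
    (uniformContinuous_baireSpc_iff hV.2.1).2 fun N _ ho => by
      obtain ⟨n, hn⟩ := hM.basis N (ho.mem_nhds N.one_mem)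
      exact ⟨n, fun x y hxy => hn (hcont n x y hxy)⟩
  obtain ⟨Φ, hΦ, -⟩ := hF.universal H hV φ hφ
  obtain ⟨Ψ, hΨ⟩ := hj.exists_extension hcomp Φ
  have hΨφ : ∀ x, Ψ (j (i x)) = φ x := fun x => (hΨ _).trans (hΦ x)
  obtain ⟨x₀, -⟩ := hsurj 1
  have hop : IsOpenMap Ψ := by
    -- For a suitable `n`, all of `M n` lies in `U`: each `g` in `M n` is the image of `(i x₀)⁻¹ * i
    -- y` with `y` in the cylinder of length `n` around `x₀`, and these elements lie in the preimage
    -- of `U`.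
    refine (IsTopologicalGroup.isOpenMap_iff_nhds_one (f := Ψ)).2 fun U hU => ?_
    have hU' : j ⁻¹' (Ψ ⁻¹' U) ∈ 𝓝 (1 : F) :=
      hj.isEmbedding.continuous.continuousAt (by rwa [map_one])
    obtain ⟨N, hN, ho, hNU⟩ := hF.mem.2.1 _ hU'
    obtain ⟨n, hn⟩ := (uniformContinuous_baireSpc_iff hF.mem.2.1).1 hF.uniformContinuous N
      hN ho
    refine mem_of_superset ((hM.isOpen n).mem_nhds (M n).one_mem) fun g hg => ?_
    obtain ⟨y, hy, hyg⟩ := hopen n x₀ (φ x₀ * g) (by simpa using hg)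
    have := hNU (hn x₀ y hy)
    simpa [hΨφ, hyg] using this
  exact ⟨_, inferInstance, nonempty_quotient_equiv Ψ.toMonoidHom Ψ.continuous_toFun hop
    fun g => (hsurj g).imp' (fun x => j (i x)) fun x hx => (hΨφ x).trans hx⟩

theorem exists_and_isSurjectivelyUniversal (L : Set (FreeGroup ℕ)) (hκ : ℵ₀ ≤ κ) :
    (∃ (C : Type u) (_ : Group C) (_ : TopologicalSpace C) (_ : IsTopologicalGroup C),
      IsCompletedFreeGroupOf (VarietyNA L) (BaireSpc κ) C) ∧
    ∀ (C : Type u) [Group C] [TopologicalSpace C] [IsTopologicalGroup C],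
      IsCompletedFreeGroupOf (VarietyNA L) (BaireSpc κ) C →
      IsSurjectivelyUniversal (MetrizableComplete (VarietyNA L) κ) C := by
  have : Nonempty κ.out := by
    rw [← mk_ne_zero_iff, mk_out]
    exact (aleph0_pos.trans_le hκ).ne'
  exact ⟨⟨(freeNA L κ).topologicalClosure, inferInstance, inferInstance, inferInstance,
    freeNA L κ, inferInstance, inferInstance, inferInstance, _, _,
    isFreeGroupOf_freeNA L, isGroupCompletion_freeNA L κ⟩,
    fun C _ _ _ h => ⟨h.metrizableComplete hκ, fun H _ _ _ hH => h.exists_quotient hH⟩⟩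

end Universality

end NAGroups

theorem theoremt (κ : Cardinal.{u}) (hκ : Cardinal.aleph0 ≤ κ) :
    -- the completed free balanced non-archimedean group over the Baire space
    ((∃ (C : Type u) (_ : Group C) (_ : TopologicalSpace C) (_ : IsTopologicalGroup C),
        NAGroups.IsCompletedFreeGroupOf NAGroups.BalancedNA (NAGroups.BaireSpc κ) C) ∧
      ∀ (C : Type u) [Group C] [TopologicalSpace C] [IsTopologicalGroup C],
        NAGroups.IsCompletedFreeGroupOf NAGroups.BalancedNA (NAGroups.BaireSpc κ) C →
        NAGroups.IsSurjectivelyUniversal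
          (NAGroups.MetrizableComplete NAGroups.BalancedNA κ) C) ∧
    -- the completed free abelian non-archimedean group over the Baire space
    ((∃ (C : Type u) (_ : Group C) (_ : TopologicalSpace C) (_ : IsTopologicalGroup C),
        NAGroups.IsCompletedFreeGroupOf NAGroups.AbelianNA (NAGroups.BaireSpc κ) C) ∧
      ∀ (C : Type u) [Group C] [TopologicalSpace C] [IsTopologicalGroup C],
        NAGroups.IsCompletedFreeGroupOf NAGroups.AbelianNA (NAGroups.BaireSpc κ) C →
        NAGroups.IsSurjectivelyUniversal
          (NAGroups.MetrizableComplete NAGroups.AbelianNA κ) C) ∧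
    -- the completed free Boolean non-archimedean group over the Baire space
    ((∃ (C : Type u) (_ : Group C) (_ : TopologicalSpace C) (_ : IsTopologicalGroup C),
        NAGroups.IsCompletedFreeGroupOf NAGroups.BooleanNA (NAGroups.BaireSpc κ) C) ∧
      ∀ (C : Type u) [Group C] [TopologicalSpace C] [IsTopologicalGroup C],
        NAGroups.IsCompletedFreeGroupOf NAGroups.BooleanNA (NAGroups.BaireSpc κ) C →
        NAGroups.IsSurjectivelyUniversal
          (NAGroups.MetrizableComplete NAGroups.BooleanNA κ) C) := by
  rw [NAGroups.balancedNA_eq, NAGroups.abelianNA_eq, NAGroups.booleanNA_eq]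
  exact ⟨NAGroups.exists_and_isSurjectivelyUniversal _ hκ,
    NAGroups.exists_and_isSurjectivelyUniversal _ hκ,
    NAGroups.exists_and_isSurjectivelyUniversal _ hκ⟩
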